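/- For each $n\ge 1$ consider the following online problem. Applicants $1,\dots,n$ arrive one per time step; their costs per time step $x_1,\dots,x_n$ are independent and uniformly distributed on $[0,1]$. When applicant $i$ arrives at time $i$, the cost $x_i$ is revealed and a duration $t_i\in\{0,1,2,\dots\}$ has to be fixed irrevocably; applicant $i$ is then employed in the time steps $i,i+1,\dots,i+t_i-1$, at cost $t_ix_i$. At least one applicant must be employed in each time step, that is, for every $i\in\{1,\dots,n\}$ there is $j\le i$ with $j+t_j>i$ (contracts may overlap and may extend beyond time $n$). An online algorithm chooses $t_i$ (measurably) depending only on $n$, on $x_1,\dots,x_i$, on $t_1,\dots,t_{i-1}$ and, if it is randomized, on internal randomness that is independent of the costs, and it satisfies the employment constraint almost surely. Let $\mathbf{E}[\mathrm{Alg}_n]\in[0,\infty]$ be its expected total cost $\mathbf{E}\bigl[\sum_{i=1}^n t_ix_i\bigr]$, and let $\mathbf{E}[\mathrm{Opt}_n]$ be the expected cost of an optimal offline algorithm, that is, the expectation of the minimum of $\sum_{i=1}^n t_ix_i$ over all durations $t_1,\dots,t_n$ that satisfy the employment constraint and may be chosen with knowledge of all of $x_1,\dots,x_n$. The competitive ratio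 of the online algorithm is $\limsup_{n\to\infty}\mathbf{E}[\mathrm{Alg}_n]/\mathbf{E}[\mathrm{Opt}_n]$. **Theorem.** For costs distributed uniformly on $[0,1]$, no online algorithm has a competitive ratio below $2$: every online algorithm satisfies $$\limsup_{n\to\infty}\frac{\mathbf{E}[\mathrm{Alg}_n]}{\mathbf{E}[\mathrm{Opt}_n]}\ \ge\ 2 .$$ -/

import Mathlib

open MeasureTheory Filter
open scoped ENNReal

universe u

namespace Hiring

/-- Applicants and time steps are indexed by `Fin n` (in order of arrival). Applicant `j`, hired on
arrival for `t j` time steps, is employed in the time steps `j, j + 1, …, j + t j - 1` (`t j = 0`: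
not hired). `Covers t` says that in each of the `n` time steps somebody is employed; contracts may
overlap and may run beyond the last time step. -/
def Covers {n : ℕ} (t : Fin n → ℕ) : Prop :=
  ∀ i : Fin n, ∃ j : Fin n, j ≤ i ∧ (i : ℕ) < (j : ℕ) + t j

/-- Total hiring cost of the durations `t` when applicant `i` costs `x i` per time step. -/
def totalCost {n : ℕ} (t : Fin n → ℕ) (x : Fin n → ℝ) : ℝ :=
  ∑ i, (t i : ℝ) * x i

/-- The law of `n` independent costs, each distributed according to `μ`. -/
noncomputable def costLaw (μ : Measure ℝ) (n : ℕ) : Measure (Fin n → ℝ) :=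
  Measure.pi fun _ => μ

/-- The uniform distribution `U[0,1]`. -/
noncomputable def uniform01 : Measure ℝ :=
  volume.restrict (Set.Icc 0 1)

/-- The costs `x_j`, `j ≤ i`, that have been revealed up to time `i`. -/
def revealed {n : ℕ} (x : Fin n → ℝ) (i : Fin n) : Set.Iic i → ℝ :=
  fun j => x j

/-- A (possibly randomized) online algorithm for `n` applicants whose costs are i.i.d. with
law `μ`. Its internal randomness is a seed, independent of the costs; deterministic algorithms have
a one-point seed space. The duration for which applicant `i` is hired is a function of the seed and
of the costs revealed up to time `i` only (earlier durations are functions of these as well).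
Almost surely somebody is employed in every time step. -/
structure OnlineAlgorithm (μ : Measure ℝ) (n : ℕ) where
  /-- the space of seeds -/
  Seed : Type u
  [measurableSpaceSeed : MeasurableSpace Seed]
  /-- the law of the seed -/
  seedLaw : Measure Seed
  [isProbabilityMeasure_seedLaw : IsProbabilityMeasure seedLaw]
  /-- the duration for which applicant `i` is hired -/
  duration : (i : Fin n) → Seed × (Set.Iic i → ℝ) → ℕ
  measurable_duration : ∀ i, Measurable (duration i)
  covers : ∀ᵐ z ∂(seedLaw.prod (costLaw μ n)),
    Covers fun i => duration i (z.1, revealed z.2 i)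

attribute [instance] OnlineAlgorithm.measurableSpaceSeed
  OnlineAlgorithm.isProbabilityMeasure_seedLaw

/-- The expected cost `E[Alg_n]` of an online algorithm, as an element of `[0, ∞]`
(costs are nonnegative). -/
noncomputable def OnlineAlgorithm.expectedCost {μ : Measure ℝ} {n : ℕ}
    (A : OnlineAlgorithm μ n) : ℝ≥0∞ :=
  ∫⁻ z, ENNReal.ofReal (totalCost (fun i => A.duration i (z.1, revealed z.2 i)) z.2)
    ∂(A.seedLaw.prod (costLaw μ n))

/-- The expected cost `E[Opt_n]` of an optimal offline algorithm, which knows all `n` costs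
in advance and chooses the cheapest feasible durations. -/
noncomputable def expectedOpt (μ : Measure ℝ) (n : ℕ) : ℝ≥0∞ :=
  ∫⁻ x, ⨅ t : {t : Fin n → ℕ // Covers t}, ENNReal.ofReal (totalCost t.1 x) ∂(costLaw μ n)

/-- The competitive ratio `limsup_n E[Alg_n] / E[Opt_n]` of an online algorithm, given by its
behaviour `A n` on instances with `n` applicants, for every `n`. -/
noncomputable def competitiveRatio {μ : Measure ℝ} (A : (n : ℕ) → OnlineAlgorithm μ n) : ℝ≥0∞ :=
  limsup (fun n => (A n).expectedCost / expectedOpt μ n) atTop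

end Hiring

/-! Cost paid so far plus `potential` is a submartingale. Write c = `rate a`, with r steps covered,
m remaining, s = r + a. If a step passes without hiring, the potential c·log(m/(as)) rises by about
c/s as long as m is much larger than s. Hiring at cost x undoes at most c·`logGap` (x(s - 1)/c) of
this, and the mean of that saving over uniform x is about c²/(2s). The rise pays for the saving as
soon as c ≤ 2, which is where the constant comes from; the parameter a makes room for lower-order
errors and costs only c = 2(1 - 2/a).

`potential_step` is the one-step inequality. Summed along a path and integrated, its saving terms
are dominated because r depends on earlier costs only (`lintegral_saving_remaining_le`), so every
online algorithm pays at least c·log(n/a²). Offline, always employing the cheapest applicant so far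
costs at most 1 + log n in expectation (`expectedOpt_le`). Hence the ratio is at least c, and a → ∞
gives the theorem. -/

namespace Hiring

/-! ### The potential and its one-step inequality -/

/-- The rate (close to `2` for large `a`) at which `potential a` grows with `log n`. -/
noncomputable def rate (a : ℝ) : ℝ := 2 * (1 - 2 / a)

lemma rate_pos {a : ℝ} (ha : 2 < a) : 0 < rate a := by
  have : 2 / a < 1 := by rw [div_lt_one (by linarith)]; exact ha
  unfold rate; linarith

/-- A lower bound for the expected future cost when the next `r` time steps are covered and `m`
time steps remain. -/
noncomputable def potential (a : ℝ) (r m : ℕ) : ℝ :=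
  rate a * max 0 (Real.log (m / (a * (r + a))))

lemma potential_nonneg {a : ℝ} (ha : 2 < a) (r m : ℕ) : 0 ≤ potential a r m :=
  mul_nonneg (rate_pos ha).le (le_max_left _ _)

lemma rate_mul_log_le_potential {a : ℝ} (ha : 2 < a) (r m : ℕ) :
    rate a * Real.log (m / (a * (r + a))) ≤ potential a r m :=
  mul_le_mul_of_nonneg_left (le_max_right _ _) (rate_pos ha).le

/-- The gap `y - 1 - log y` in the tangent inequality for the logarithm, cut off at `y = 1`. -/
noncomputable def logGap (y : ℝ) : ℝ := if y ≤ 1 then y - 1 - Real.log y else 0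

lemma logGap_nonneg {y : ℝ} (hy : 0 < y) : 0 ≤ logGap y := by
  unfold logGap
  split_ifs
  · linarith [Real.log_le_sub_one_of_pos hy]
  · exact le_rfl

lemma measurable_logGap : Measurable logGap :=
  Measurable.ite measurableSet_Iic (by fun_prop) measurable_const

/-- The most that can be saved by hiring an applicant of cost `x`, when `r` time steps are
covered and `m` remain. -/
noncomputable def saving (a : ℝ) (m r : ℕ) (x : ℝ) : ℝ :=
  if a * (r + a) < m then rate a * logGap (x * ((r + a - 1) / rate a)) else 0

/-- A bound for the expectation of `saving a m r`. -/
noncomputable def savingBound (a : ℝ) (m r : ℕ) : ℝ :=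
  if a * (r + a) < m then rate a ^ 2 / (2 * (r + a - 1)) else 0

lemma saving_nonneg {a : ℝ} (ha : 2 < a) (m r : ℕ) {x : ℝ} (hx : 0 < x) :
    0 ≤ saving a m r x := by
  have hc := rate_pos ha
  have hr : (0 : ℝ) ≤ r := r.cast_nonneg
  unfold saving
  split_ifs
  · exact mul_nonneg hc.le (logGap_nonneg (mul_pos hx (div_pos (by linarith) hc)))
  · exact le_rfl

lemma savingBound_nonneg {a : ℝ} (ha : 2 < a) (m r : ℕ) : 0 ≤ savingBound a m r := by
  have hr : (0 : ℝ) ≤ r := r.cast_nonneg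
  unfold savingBound
  split_ifs
  · exact div_nonneg (sq_nonneg _) (by linarith)
  · exact le_rfl

lemma savingBound_le {a : ℝ} (ha : 2 < a) (m r : ℕ) : savingBound a m r ≤ rate a ^ 2 := by
  have hr : (0 : ℝ) ≤ r := r.cast_nonneg
  unfold savingBound
  split_ifs
  · exact div_le_self (sq_nonneg _) (by linarith)
  · exact sq_nonneg _

lemma measurable_saving (a : ℝ) (m r : ℕ) : Measurable (saving a m r) := by
  unfold saving
  split_ifs
  · exact (measurable_logGap.comp (by fun_prop)).const_mul _
  · exact measurable_const

/-- The potential lost in one time step without hiring exceeds the expected saving. -/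
lemma log_add_savingBound_le {a : ℝ} (ha : 2 < a) {r m : ℕ}
    (h : a * (r + a) < (m + 1 : ℕ)) :
    rate a * Real.log ((m + 1 : ℕ) / (a * (r + a))) + rate a ^ 2 / (2 * (r + a - 1)) ≤
      rate a * Real.log (m / (a * (r + a - 1))) := by
  have hc := rate_pos ha
  have hr : (0 : ℝ) ≤ r := r.cast_nonneg
  push_cast at h ⊢
  set s : ℝ := r + a with hs
  have hsa : a ≤ s := by linarith
  have hp : 0 < s - 1 := by linarith
  have hs0 : 0 < s := by linarith
  have ha0 : 0 < a := by linarith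
  have hmp : a * (s - 1) ≤ m := by nlinarith
  have hm : (0 : ℝ) < m := lt_of_lt_of_le (mul_pos ha0 hp) hmp
  have h1 : Real.log ((m + 1) / m) ≤ 1 / m := by
    have := Real.log_le_sub_one_of_pos (show (0 : ℝ) < (m + 1) / m by positivity)
    have e : ((m : ℝ) + 1) / m - 1 = 1 / m := by field_simp; ring
    linarith
  have h2 : Real.log ((s - 1) / s) ≤ -(1 / s) := by
    have := Real.log_le_sub_one_of_pos (show 0 < (s - 1) / s by positivity)
    have e : (s - 1) / s - 1 = -(1 / s) := by field_simp; ring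
    linarith
  rw [Real.log_div (by positivity) hm.ne'] at h1
  rw [Real.log_div hp.ne' hs0.ne'] at h2
  rw [Real.log_div (by positivity) (by positivity), Real.log_div hm.ne' (by positivity),
    Real.log_mul ha0.ne' hs0.ne', Real.log_mul ha0.ne' hp.ne']
  have h3 : 1 / (m : ℝ) ≤ 1 / (a * (s - 1)) :=
    one_div_le_one_div_of_le (mul_pos ha0 hp) hmp
  have h4 : 1 / (s - 1) - 1 / (a * (s - 1)) ≤ 1 / s := by
    rw [← sub_nonneg]
    have e : 1 / s - (1 / (s - 1) - 1 / (a * (s - 1))) = (s - a) / (a * s * (s - 1)) := by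
      field_simp; ring
    rw [e]
    exact div_nonneg (by linarith) (by positivity)
  -- The factor 1 - 2/a in `rate` leaves two spare terms 1/(a(s-1)): one absorbs 1/m (`h3`), the
  -- other the difference of 1/(s-1) and 1/s (`h4`).
  have h5 : rate a / (2 * (s - 1)) = 1 / (s - 1) - 2 * (1 / (a * (s - 1))) := by
    unfold rate; field_simp
  have h6 : rate a ^ 2 / (2 * (s - 1)) = rate a * (rate a / (2 * (s - 1))) := by ring
  rw [h6, ← mul_add]
  refine mul_le_mul_of_nonneg_left ?_ hc.le
  rw [h5]
  linarith

/-- Hiring at cost `x` for `d` time steps does not save more than `logGap` allows. -/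
lemma rate_mul_log_le_add_logGap {c p a x : ℝ} {d : ℕ} (hc : 0 < c) (hp : 0 < p)
    (ha : 1 ≤ a) (hap : a ≤ p + 1) (hx : 0 < x) (hd : 1 ≤ d) :
    c * Real.log ((d - 1 + a) / p) ≤ d * x + c * logGap (x * (p / c)) := by
  have hd' : (1 : ℝ) ≤ d := by exact_mod_cast hd
  have hu : 0 < (d : ℝ) - 1 + a := by linarith
  unfold logGap
  split_ifs with hy
  · have hy0 : 0 < x * (p / c) := by positivity
    -- Applying the tangent inequality to the product u·y, with y = xp/c, makes c·u·y linear in d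
    -- with slope x; the rest is the gap at y.
    have h := Real.log_le_sub_one_of_pos (show 0 < (d - 1 + a) / p * (x * (p / c)) by positivity)
    rw [Real.log_mul (by positivity) hy0.ne'] at h
    have e : (d - 1 + a) / p * (x * (p / c)) = (d - 1 + a) * x / c := by field_simp
    rw [e] at h
    have h' := mul_le_mul_of_nonneg_left h hc.le
    have e2 : c * ((d - 1 + a) * x / c - 1) = (d - 1 + a) * x - c := by field_simp
    have e3 : c * (x * (p / c)) = x * p := by field_simp
    rw [e2] at h'
    have : (a - 1) * x ≤ p * x := mul_le_mul_of_nonneg_right (by linarith) hx.le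
    rw [mul_sub, mul_sub, e3]
    linarith
  -- Here x ≥ c/p is so expensive that the gain in potential never exceeds the price d·x.
  · have h := Real.log_le_sub_one_of_pos (show 0 < (d - 1 + a) / p by positivity)
    have h2 : (d - 1 + a) / p - 1 ≤ d / p := by
      rw [div_sub_one hp.ne']
      exact div_le_div_of_nonneg_right (by linarith) hp.le
    have h3 : c / p ≤ x := by
      rw [div_le_iff₀ hp]
      have := (not_le.1 hy).le
      rwa [← mul_div_assoc, le_div_iff₀ hc, one_mul] at this
    calc c * Real.log ((d - 1 + a) / p) ≤ c * (d / p) :=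
          mul_le_mul_of_nonneg_left (h.trans h2) hc.le
      _ = d * (c / p) := by ring
      _ ≤ d * x := mul_le_mul_of_nonneg_left h3 (by positivity)
      _ = _ := by ring

/-- One step of the online problem: the potential plus the bound on the expected saving is at
most the cost incurred plus the new potential plus the actual saving. -/
lemma potential_step {a : ℝ} (ha : 2 < a) {r m d : ℕ} {x : ℝ} (hx : 0 < x)
    (hd : r = 0 → d ≠ 0) :
    potential a r (m + 1) + savingBound a (m + 1) r ≤
      d * x + potential a (max r d - 1) m + saving a (m + 1) r x := by
  have hc := rate_pos ha
  have hr : (0 : ℝ) ≤ r := r.cast_nonneg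
  have ha0 : 0 < a := by linarith
  have hs0 : 0 < a * (r + a) := by positivity
  by_cases h : a * (r + a) < (m + 1 : ℕ)
  · have hpot : potential a r (m + 1) =
        rate a * Real.log ((m + 1 : ℕ) / (a * (r + a))) := by
      unfold potential
      rw [max_eq_right (Real.log_nonneg ((one_le_div hs0).2 h.le))]
    have hp : 0 < (r : ℝ) + a - 1 := by linarith
    have hm : (0 : ℝ) < m := by push_cast at h; nlinarith
    rw [hpot, savingBound, if_pos h]
    refine (log_add_savingBound_le ha h).trans ?_
    rw [saving, if_pos h]
    have hq := rate_mul_log_le_potential ha (max r d - 1) m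
    rcases le_or_gt d r with hdr | hdr
    -- A contract with d ≤ r adds no coverage, so its cost can be dropped.
    · have hr1 : 1 ≤ r := by
        by_contra h0
        have : r = 0 := by omega
        exact hd this (by omega)
      rw [max_eq_left hdr] at hq ⊢
      rw [Nat.cast_sub hr1, Nat.cast_one, sub_add_eq_add_sub] at hq
      have h1 : 0 ≤ d * x := by positivity
      have h2 := mul_nonneg hc.le (logGap_nonneg
        (mul_pos hx (div_pos hp hc) : 0 < x * ((r + a - 1) / rate a)))
      linarith
    · have hd1 : 1 ≤ d := by omega
      rw [max_eq_right hdr.le] at hq ⊢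
      rw [Nat.cast_sub hd1, Nat.cast_one] at hq
      have hd' : (1 : ℝ) ≤ d := by exact_mod_cast hd1
      have h1 := rate_mul_log_le_add_logGap hc hp (by linarith : 1 ≤ a) (by linarith) hx hd1
      have e : Real.log (m / (a * (r + a - 1))) =
          Real.log (m / (a * (d - 1 + a))) + Real.log ((d - 1 + a) / (r + a - 1)) := by
        have hu : 0 < (d : ℝ) - 1 + a := by linarith
        rw [← Real.log_mul (by positivity) (by positivity)]
        congr 1
        field_simp
      rw [e, mul_add]
      linarith
  · have hpot : potential a r (m + 1) = 0 := by
      unfold potential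
      rw [max_eq_left (Real.log_nonpos (by positivity) ((div_le_one hs0).2 (not_lt.1 h))),
        mul_zero]
    rw [hpot, savingBound, saving, if_neg h, if_neg h]
    have := potential_nonneg ha (max r d - 1) m
    have : 0 ≤ d * x := by positivity
    linarith

/-! ### Bookkeeping of coverage and the pathwise bound -/

/-- The number of time steps from `k` on that are covered by contracts made before time `k`. -/
def remaining (t : ℕ → ℕ) : ℕ → ℕ
  | 0 => 0
  | k + 1 => max (remaining t k) (t k) - 1

lemma add_le_add_remaining (t : ℕ → ℕ) {j k : ℕ} (h : j < k) : j + t j ≤ k + remaining t k := by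
  induction k with
  | zero => omega
  | succ k ih =>
    rw [remaining]
    rcases Nat.lt_succ_iff_lt_or_eq.1 h with h | rfl
    · have := ih h
      omega
    · omega

lemma remaining_congr {t t' : ℕ → ℕ} {k : ℕ} (h : ∀ j < k, t j = t' j) :
    remaining t k = remaining t' k := by
  induction k with
  | zero => rfl
  | succ k ih =>
    rw [remaining, remaining, ih fun j hj => h j (by omega), h k (by omega)]

/-- Pathwise lower bound for the cost of covering `n` time steps. -/
lemma potential_add_sum_savingBound_le {a : ℝ} (ha : 2 < a) {n : ℕ} {t : ℕ → ℕ} {x : ℕ → ℝ}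
    (hx : ∀ i < n, 0 < x i) (ht : ∀ i < n, remaining t i = 0 → t i ≠ 0) :
    potential a 0 n + ∑ i ∈ Finset.range n, savingBound a (n - i) (remaining t i) ≤
      ∑ i ∈ Finset.range n, t i * x i +
        ∑ i ∈ Finset.range n, saving a (n - i) (remaining t i) (x i) := by
  have key : ∀ k ≤ n,
      potential a 0 n + ∑ i ∈ Finset.range k, savingBound a (n - i) (remaining t i) ≤
      ∑ i ∈ Finset.range k, t i * x i + potential a (remaining t k) (n - k) +
        ∑ i ∈ Finset.range k, saving a (n - i) (remaining t i) (x i) := by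
    intro k
    induction k with
    | zero => intro; simp [remaining]
    | succ k ih =>
      intro hk
      have h1 := ih (by omega)
      have h2 := potential_step ha (m := n - (k + 1)) (hx k hk) (ht k hk)
      rw [show n - (k + 1) + 1 = n - k by omega] at h2
      rw [Finset.sum_range_succ, Finset.sum_range_succ, Finset.sum_range_succ, remaining]
      linarith
  have := key n le_rfl
  -- The final potential vanishes because `Real.log 0 = 0`.
  have h0 : potential a (remaining t n) (n - n) = 0 := by simp [potential]
  linarith

/-! ### Averaging the saving over one cost -/

lemma integral_logGap : ∫ y in (0 : ℝ)..1, (y - 1 - Real.log y) = 1 / 2 := by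
  have h1 : IntervalIntegrable (fun y : ℝ => y - 1) volume 0 1 :=
    Continuous.intervalIntegrable (by fun_prop) _ _
  rw [intervalIntegral.integral_sub h1 intervalIntegral.intervalIntegrable_log',
    intervalIntegral.integral_sub (by simp) (by simp), integral_log]
  simp

/-- The expected saving is bounded by `savingBound`. -/
lemma lintegral_saving_le {a : ℝ} (ha : 2 < a) (m r : ℕ) :
    ∫⁻ x, ENNReal.ofReal (saving a m r x) ∂uniform01 ≤ ENNReal.ofReal (savingBound a m r) := by
  have hc := rate_pos ha
  have hr : (0 : ℝ) ≤ r := r.cast_nonneg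
  have hp : 0 < (r : ℝ) + a - 1 := by linarith
  by_cases h : a * (r + a) < m
  swap
  · simp [saving, h]
  set b : ℝ := (r + a - 1) / rate a with hb
  have hb0 : 0 < b := div_pos hp hc
  have hint : IntervalIntegrable (fun x : ℝ => x * b - 1 - Real.log (x * b)) volume 0 b⁻¹ := by
    have h0 : IntervalIntegrable (fun y : ℝ => y - 1 - Real.log y) volume 0 1 :=
      (Continuous.intervalIntegrable (by fun_prop) _ _).sub
        intervalIntegral.intervalIntegrable_log'
    have := h0.comp_mul_right (c := b)
    simpa using this
  have hval : ∫ x in (0 : ℝ)..b⁻¹, (x * b - 1 - Real.log (x * b)) = b⁻¹ * (1 / 2) := by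
    rw [intervalIntegral.integral_comp_mul_right (fun y => y - 1 - Real.log y) hb0.ne',
      zero_mul, inv_mul_cancel₀ hb0.ne', integral_logGap, smul_eq_mul]
  have hg : ∀ x ∈ Set.Ioc (0 : ℝ) b⁻¹, 0 ≤ rate a * (x * b - 1 - Real.log (x * b)) := by
    intro x hx
    have := Real.log_le_sub_one_of_pos (mul_pos hx.1 hb0)
    exact mul_nonneg hc.le (by linarith)
  have hi2 : IntegrableOn (fun x : ℝ => rate a * (x * b - 1 - Real.log (x * b)))
      (Set.Ioc 0 b⁻¹) := by
    rw [← intervalIntegrable_iff_integrableOn_Ioc_of_le (inv_pos.2 hb0).le]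
    exact hint.const_mul _
  calc ∫⁻ x, ENNReal.ofReal (saving a m r x) ∂uniform01
      = ∫⁻ x in Set.Ioc (0 : ℝ) 1, ENNReal.ofReal (saving a m r x) := by
        rw [uniform01]
        exact setLIntegral_congr Ioc_ae_eq_Icc.symm
    -- Only an upper bound is needed; enlarging the domain avoids comparing `b⁻¹` with 1.
    _ ≤ ∫⁻ x in Set.Ioi (0 : ℝ), ENNReal.ofReal (saving a m r x) :=
        lintegral_mono_set fun x hx => hx.1
    _ = ∫⁻ x in Set.Ioi (0 : ℝ), (Set.Ioc (0 : ℝ) b⁻¹).indicator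
          (fun x => ENNReal.ofReal (rate a * (x * b - 1 - Real.log (x * b)))) x := by
        refine setLIntegral_congr_fun measurableSet_Ioi fun x hx => ?_
        have e : x * b ≤ 1 ↔ x ≤ b⁻¹ := by rw [le_inv_comm₀ hx hb0, inv_eq_one_div, le_div_iff₀ hx, mul_comm]
        rw [saving, if_pos h, ← hb, logGap]
        by_cases hxb : x ≤ b⁻¹
        · rw [Set.indicator_of_mem (show x ∈ Set.Ioc 0 b⁻¹ from ⟨hx, hxb⟩), if_pos (e.2 hxb)]
        · rw [Set.indicator_of_notMem (fun hm => hxb hm.2), if_neg (mt e.1 hxb), mul_zero,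
            ENNReal.ofReal_zero]
    _ ≤ ∫⁻ x, (Set.Ioc (0 : ℝ) b⁻¹).indicator
          (fun x => ENNReal.ofReal (rate a * (x * b - 1 - Real.log (x * b)))) x :=
        setLIntegral_le_lintegral _ _
    _ = ∫⁻ x in Set.Ioc (0 : ℝ) b⁻¹, ENNReal.ofReal (rate a * (x * b - 1 - Real.log (x * b))) :=
        lintegral_indicator measurableSet_Ioc _
    _ = ENNReal.ofReal (∫ x in Set.Ioc (0 : ℝ) b⁻¹, rate a * (x * b - 1 - Real.log (x * b))) := by
        rw [ofReal_integral_eq_lintegral_ofReal hi2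
          ((ae_restrict_iff' measurableSet_Ioc).2 (ae_of_all _ hg))]
    _ = ENNReal.ofReal (savingBound a m r) := by
        rw [← intervalIntegral.integral_of_le (inv_pos.2 hb0).le,
          intervalIntegral.integral_const_mul, hval, savingBound, if_pos h, hb]
        congr 1
        field_simp


instance : IsProbabilityMeasure uniform01 := ⟨by simp [uniform01]⟩

instance (μ : Measure ℝ) [IsProbabilityMeasure μ] (n : ℕ) :
    IsProbabilityMeasure (costLaw μ n) := by
  unfold costLaw; infer_instance

lemma ae_uniform01_mem_Ioc : ∀ᵐ x ∂uniform01, x ∈ Set.Ioc (0 : ℝ) 1 := by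
  have : uniform01 = volume.restrict (Set.Ioc 0 1) :=
    (Measure.restrict_congr_set Ioc_ae_eq_Icc).symm
  rw [this]
  exact ae_restrict_mem measurableSet_Ioc

lemma ae_costLaw_mem_Ioc (n : ℕ) :
    ∀ᵐ x ∂costLaw uniform01 n, ∀ i, x i ∈ Set.Ioc (0 : ℝ) 1 := by
  refine ae_all_iff.2 fun i => ?_
  exact (measurePreserving_eval (fun _ : Fin n => uniform01) i).quasiMeasurePreserving.ae
    ae_uniform01_mem_Ioc

/-- If `r` does not depend on coordinate `i`, that coordinate can be averaged first. -/
lemma lintegral_costLaw_le_of_update {μ : Measure ℝ} [IsProbabilityMeasure μ] {n : ℕ}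
    (i : Fin n) {r : (Fin n → ℝ) → ℕ} (hr : Measurable r)
    (hri : ∀ x y, r (Function.update x i y) = r x) {q : ℕ → ℝ → ℝ≥0∞} {Q : ℕ → ℝ≥0∞}
    (hq : ∀ k, Measurable (q k)) (h : ∀ k, ∫⁻ y, q k y ∂μ ≤ Q k) :
    ∫⁻ x, q (r x) (x i) ∂costLaw μ n ≤ ∫⁻ x, Q (r x) ∂costLaw μ n := by
  have hq' : Measurable (Function.uncurry q) := measurable_from_prod_countable_right hq
  have hQ' : Measurable Q := measurable_from_top
  refine lintegral_le_of_lmarginal_le (μ := fun _ : Fin n => μ) {i}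
    (hq'.comp (hr.prodMk (measurable_pi_apply i))) (hQ'.comp hr) fun x => ?_
  simp only [lmarginal_singleton, hri, Function.update_self]
  simpa using h (r x)

/-! ### Lower bound for online algorithms -/

namespace OnlineAlgorithm

variable {μ : Measure ℝ} {n : ℕ}

/-- The durations fixed by an online algorithm, extended by `0` beyond the last applicant. -/
def contracts (A : OnlineAlgorithm.{u} μ n) (z : A.Seed × (Fin n → ℝ)) (k : ℕ) : ℕ :=
  if h : k < n then A.duration ⟨k, h⟩ (z.1, revealed z.2 ⟨k, h⟩) else 0

lemma contracts_val (A : OnlineAlgorithm.{u} μ n) (z : A.Seed × (Fin n → ℝ)) (i : Fin n) :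
    A.contracts z i = A.duration i (z.1, revealed z.2 i) := by
  simp [contracts]

lemma measurable_contracts (A : OnlineAlgorithm.{u} μ n) (k : ℕ) :
    Measurable fun z => A.contracts z k := by
  unfold contracts
  split_ifs with h
  · refine (A.measurable_duration ⟨k, h⟩).comp (measurable_fst.prodMk ?_)
    exact measurable_pi_lambda _ fun j => (measurable_pi_apply _).comp measurable_snd
  · exact measurable_const

lemma measurable_remaining_contracts (A : OnlineAlgorithm.{u} μ n) (k : ℕ) :
    Measurable fun z => remaining (A.contracts z) k := by
  induction k with
  | zero => exact measurable_const
  | succ k ih =>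
    exact (measurable_from_top (f := fun p : ℕ => p - 1)).comp
      (ih.max (A.measurable_contracts k))

/-- Coverage on arrival of applicant i is fixed by earlier contracts, which see only earlier costs.
This is the only use of the online restriction. -/
lemma remaining_contracts_update (A : OnlineAlgorithm.{u} μ n) (ω : A.Seed) (i : Fin n)
    (x : Fin n → ℝ) (y : ℝ) :
    remaining (A.contracts (ω, Function.update x i y)) i =
      remaining (A.contracts (ω, x)) i := by
  refine remaining_congr fun j hj => ?_
  have hjn : j < n := hj.trans i.2
  simp only [contracts, dif_pos hjn]
  congr 2
  funext l
  have hl : (l : Fin n) ≤ ⟨j, hjn⟩ := l.2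
  exact Function.update_of_ne (ne_of_lt (lt_of_le_of_lt hl hj)) _ _

lemma contracts_ne_zero (A : OnlineAlgorithm.{u} μ n) {z : A.Seed × (Fin n → ℝ)}
    (h : Covers fun i => A.duration i (z.1, revealed z.2 i)) {i : ℕ} (hi : i < n)
    (hr : remaining (A.contracts z) i = 0) : A.contracts z i ≠ 0 := by
  intro h0
  obtain ⟨j, hj, hij⟩ := h ⟨i, hi⟩
  simp only [← contracts_val] at hij
  have hj : (j : ℕ) ≤ i := hj
  rcases hj.lt_or_eq with hj | hj
  · have := add_le_add_remaining (A.contracts z) hj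
    omega
  · rw [hj, h0] at hij
    simp at hij

lemma measurable_saving_remaining (A : OnlineAlgorithm.{u} μ n) (a : ℝ) (m : ℕ) (i : Fin n) :
    Measurable fun z : A.Seed × (Fin n → ℝ) =>
      ENNReal.ofReal (saving a m (remaining (A.contracts z) i) (z.2 i)) := by
  have h : Measurable (Function.uncurry (saving a m)) :=
    measurable_from_prod_countable_right fun k => measurable_saving a m k
  have hg : Measurable fun z : A.Seed × (Fin n → ℝ) => (remaining (A.contracts z) i, z.2 i) :=
    (A.measurable_remaining_contracts i).prodMk ((measurable_pi_apply i).comp measurable_snd)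
  exact (h.comp hg).ennreal_ofReal

lemma measurable_savingBound_remaining (A : OnlineAlgorithm.{u} μ n) (a : ℝ) (m : ℕ)
    (i : Fin n) : Measurable fun z : A.Seed × (Fin n → ℝ) =>
      ENNReal.ofReal (savingBound a m (remaining (A.contracts z) i)) :=
  (measurable_from_top (f := fun k => ENNReal.ofReal (savingBound a m k))).comp
    (A.measurable_remaining_contracts i)

/-- For a fixed seed, the coverage does not depend on the i-th cost, so that cost can be averaged
first. -/
lemma lintegral_saving_remaining_le {a : ℝ} (ha : 2 < a) (A : OnlineAlgorithm.{u} uniform01 n)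
    (m : ℕ) (i : Fin n) :
    ∫⁻ z, ENNReal.ofReal (saving a m (remaining (A.contracts z) i) (z.2 i))
        ∂(A.seedLaw.prod (costLaw uniform01 n)) ≤
      ∫⁻ z, ENNReal.ofReal (savingBound a m (remaining (A.contracts z) i))
        ∂(A.seedLaw.prod (costLaw uniform01 n)) := by
  have hR := A.measurable_remaining_contracts i
  rw [lintegral_prod _ (A.measurable_saving_remaining a m i).aemeasurable,
    lintegral_prod _ (A.measurable_savingBound_remaining a m i).aemeasurable]
  refine lintegral_mono fun ω => ?_
  exact lintegral_costLaw_le_of_update (q := fun k x => ENNReal.ofReal (saving a m k x))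
    (Q := fun k => ENNReal.ofReal (savingBound a m k)) i
    (hR.comp measurable_prodMk_left) (A.remaining_contracts_update ω i)
    (fun k => (measurable_saving a m k).ennreal_ofReal) (lintegral_saving_le ha m)

lemma potential_add_savings_ae {a : ℝ} (ha : 2 < a) (A : OnlineAlgorithm.{u} uniform01 n) :
    ∀ᵐ z ∂(A.seedLaw.prod (costLaw uniform01 n)),
      ENNReal.ofReal (potential a 0 n) +
        ∑ i : Fin n, ENNReal.ofReal (savingBound a (n - i) (remaining (A.contracts z) i)) ≤
      ENNReal.ofReal (totalCost (fun i => A.duration i (z.1, revealed z.2 i)) z.2) +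
        ∑ i : Fin n, ENNReal.ofReal (saving a (n - i) (remaining (A.contracts z) i) (z.2 i)) := by
  have hx := (Measure.quasiMeasurePreserving_snd (μ := A.seedLaw)
    (ν := costLaw uniform01 n)).ae (ae_costLaw_mem_Ioc n)
  filter_upwards [A.covers, hx] with z hz hx
  have h := potential_add_sum_savingBound_le ha (n := n) (t := A.contracts z)
    (x := fun k => if h : k < n then z.2 ⟨k, h⟩ else 0)
    (fun i hi => by simpa [hi] using (hx ⟨i, hi⟩).1)
    (fun i hi hr => A.contracts_ne_zero hz hi hr)
  simp only [Finset.sum_range, Fin.is_lt, dite_true, Fin.eta, contracts_val] at h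
  rw [← ENNReal.ofReal_sum_of_nonneg fun i _ => savingBound_nonneg ha _ _,
    ← ENNReal.ofReal_sum_of_nonneg fun i _ => saving_nonneg ha _ _ (hx i).1,
    ← ENNReal.ofReal_add (potential_nonneg ha _ _)
      (Finset.sum_nonneg fun i _ => savingBound_nonneg ha _ _),
    ← ENNReal.ofReal_add
      (show 0 ≤ totalCost _ z.2 from
        Finset.sum_nonneg fun i _ => mul_nonneg (Nat.cast_nonneg _) (hx i).1.le)
      (Finset.sum_nonneg fun i _ => saving_nonneg ha _ _ (hx i).1)]
  exact ENNReal.ofReal_le_ofReal h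

/-- The potential at the start bounds the expected cost of every online algorithm from below. -/
lemma potential_le_expectedCost {a : ℝ} (ha : 2 < a) (A : OnlineAlgorithm.{u} uniform01 n) :
    ENNReal.ofReal (potential a 0 n) ≤ A.expectedCost := by
  set P := A.seedLaw.prod (costLaw uniform01 n) with hP
  have h1 := fun i : Fin n => A.measurable_saving_remaining a (n - i) i
  have h2 := fun i : Fin n => A.measurable_savingBound_remaining a (n - i) i
  have h := lintegral_mono_ae (A.potential_add_savings_ae ha)
  rw [lintegral_add_left measurable_const,
    lintegral_add_right _ (Finset.measurable_sum _ fun i _ => h1 i),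
    lintegral_finsetSum _ fun i _ => h1 i, lintegral_finsetSum _ fun i _ => h2 i,
    lintegral_const, measure_univ, mul_one] at h
  -- Finiteness permits cancelling this sum in `ℝ≥0∞`.
  have hfin : ∑ i : Fin n, ∫⁻ z, ENNReal.ofReal
      (savingBound a (n - i) (remaining (A.contracts z) i)) ∂P ≠ ∞ := by
    refine ENNReal.sum_ne_top.2 fun i _ => ne_top_of_le_ne_top
      (ENNReal.ofReal_ne_top (r := rate a ^ 2)) ?_
    refine (lintegral_mono fun z => ENNReal.ofReal_le_ofReal (savingBound_le ha _ _)).trans ?_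
    simp
  refine (ENNReal.add_le_add_iff_right hfin).1 (h.trans ?_)
  exact add_le_add le_rfl
    (Finset.sum_le_sum fun i _ => A.lintegral_saving_remaining_le ha _ i)

end OnlineAlgorithm

/-! ### Upper bound for the offline optimum -/

/-- The cheapest of the applicants that have arrived up to time `i`. -/
noncomputable def prefixMin {n : ℕ} (x : Fin n → ℝ) (i : Fin n) : ℝ :=
  (Finset.Iic i).inf' Finset.nonempty_Iic x

lemma prefixMin_nonneg {n : ℕ} {x : Fin n → ℝ} (hx : ∀ i, 0 ≤ x i) (i : Fin n) :
    0 ≤ prefixMin x i :=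
  Finset.le_inf' _ _ fun j _ => hx j

lemma measurable_prefixMin {n : ℕ} (i : Fin n) :
    Measurable fun x : Fin n → ℝ => prefixMin x i :=
  (Continuous.finset_inf'_apply Finset.nonempty_Iic fun j _ => continuous_apply j).measurable

/-- Always employing the cheapest applicant so far is feasible. -/
lemma exists_covers_totalCost_eq {n : ℕ} (x : Fin n → ℝ) :
    -- The lexicographic order used below breaks ties towards the earliest applicant. Then the times
    -- at which j is best form an interval starting at j (if there are any), and their number serves
    -- as its duration.
    ∃ t : Fin n → ℕ, Covers t ∧ totalCost t x = ∑ i, prefixMin x i := by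
  have hbest : ∀ i : Fin n, ∃ j ∈ Finset.Iic i, ∀ k ∈ Finset.Iic i,
      toLex (x j, j) ≤ toLex (x k, k) := fun i =>
    Finset.exists_min_image _ (fun k => toLex (x k, k)) Finset.nonempty_Iic
  choose best hle hmin using hbest
  simp only [Finset.mem_Iic] at hle hmin
  have hstable : ∀ i l, best i ≤ l → l ≤ i → best l = best i := fun i l h1 h2 => by
    have := le_antisymm (hmin l _ h1) (hmin i _ ((hle l).trans h2))
    simpa using congrArg (fun p => (ofLex p).2) this
  refine ⟨fun j => (Finset.univ.filter fun i => best i = j).card, fun i => ?_, ?_⟩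
  · refine ⟨best i, hle i, ?_⟩
    have hsub : Finset.Icc (best i) i ⊆ Finset.univ.filter fun l => best l = best i := by
      intro l hl
      rw [Finset.mem_Icc] at hl
      exact Finset.mem_filter.2 ⟨Finset.mem_univ _, hstable i l hl.1 hl.2⟩
    have := Finset.card_le_card hsub
    rw [Fin.card_Icc] at this
    have h' : (best i : ℕ) ≤ i := hle i
    simp only
    omega
  · have hpm : ∀ i, prefixMin x i = x (best i) := fun i => by
      refine le_antisymm (Finset.inf'_le _ (Finset.mem_Iic.2 (hle i))) ?_
      refine Finset.le_inf' _ _ fun k hk => ?_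
      rcases (Prod.Lex.toLex_le_toLex).1 (hmin i k (Finset.mem_Iic.1 hk)) with h | h
      · exact h.le
      · exact h.1.le
    simp only [totalCost, hpm]
    rw [← Finset.sum_fiberwise Finset.univ best fun i => x (best i)]
    refine Finset.sum_congr rfl fun j _ => ?_
    rw [← nsmul_eq_mul, ← Finset.sum_const]
    exact Finset.sum_congr rfl fun i hi => by rw [(Finset.mem_filter.1 hi).2]

lemma costLaw_lt_prefixMin {n : ℕ} (i : Fin n) {t : ℝ} (ht : 0 < t) :
    costLaw uniform01 n {x | t < prefixMin x i} = ENNReal.ofReal (1 - t) ^ (i + 1 : ℕ) := by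
  have hset : {x : Fin n → ℝ | t < prefixMin x i} =
      Set.univ.pi fun j => if j ≤ i then Set.Ioi t else Set.univ := by
    ext x
    simp only [prefixMin, Set.mem_ofPred_eq, Finset.lt_inf'_iff, Finset.mem_Iic, Set.mem_pi,
      Set.mem_univ, true_implies]
    refine forall_congr' fun j => ?_
    split_ifs with h <;> simp [h]
  have hIoi : uniform01 (Set.Ioi t) = ENNReal.ofReal (1 - t) := by
    rw [uniform01, Measure.restrict_apply measurableSet_Ioi]
    have : Set.Ioi t ∩ Set.Icc 0 1 = Set.Ioc t 1 := by
      ext x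
      simp only [Set.mem_inter_iff, Set.mem_Ioi, Set.mem_Icc, Set.mem_Ioc]
      exact ⟨fun h => ⟨h.1, h.2.2⟩, fun h => ⟨h.1, by linarith [h.1], h.2⟩⟩
    rw [this, Real.volume_Ioc]
  rw [hset, costLaw, Measure.pi_pi]
  have : ∀ j, uniform01 (if j ≤ i then Set.Ioi t else Set.univ) =
      if j ≤ i then ENNReal.ofReal (1 - t) else 1 := fun j => by
    split_ifs
    · exact hIoi
    · exact measure_univ
  simp only [this]
  rw [Finset.prod_ite, Finset.prod_const_one, mul_one, Finset.prod_const]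
  congr 1
  rw [Finset.filter_ge_eq_Iic, Fin.card_Iic]

/-- Layer-cake formula: the tail (1 - t)^(i+1) is integrated over [0,1]. With indices from 0, the
minimum is over i + 1 costs. -/
lemma lintegral_prefixMin {n : ℕ} (i : Fin n) :
    ∫⁻ x, ENNReal.ofReal (prefixMin x i) ∂costLaw uniform01 n =
      ENNReal.ofReal (1 / ((i : ℝ) + 2)) := by
  have hnn : 0 ≤ᵐ[costLaw uniform01 n] fun x => prefixMin x i := by
    filter_upwards [ae_costLaw_mem_Ioc n] with x hx
    exact prefixMin_nonneg (fun j => (hx j).1.le) i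
  rw [lintegral_eq_lintegral_meas_lt _ hnn (measurable_prefixMin i).aemeasurable,
    setLIntegral_congr_fun measurableSet_Ioi fun t ht => costLaw_lt_prefixMin i ht,
    ← Set.Ioc_union_Ioi_eq_Ioi (zero_le_one (α := ℝ)),
    lintegral_union measurableSet_Ioi (Set.Ioc_disjoint_Ioi le_rfl),
    setLIntegral_congr_fun (s := Set.Ioi (1 : ℝ)) (g := fun _ => 0) measurableSet_Ioi
      (fun t ht => by
        rw [ENNReal.ofReal_of_nonpos (by linarith [Set.mem_Ioi.1 ht]), zero_pow (by omega)]),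
    lintegral_zero, add_zero,
    setLIntegral_congr_fun (g := fun t => ENNReal.ofReal ((1 - t) ^ (i + 1 : ℕ)))
      measurableSet_Ioc
      (fun t ht => (ENNReal.ofReal_pow (by linarith [ht.2]) _).symm),
    ← ofReal_integral_eq_lintegral_ofReal
      ((Continuous.integrableOn_Icc (by fun_prop)).mono_set Set.Ioc_subset_Icc_self)
      ((ae_restrict_iff' measurableSet_Ioc).2 (ae_of_all _ fun t ht =>
        pow_nonneg (by linarith [ht.2]) _)),
    ← intervalIntegral.integral_of_le zero_le_one,
    intervalIntegral.integral_comp_sub_left (fun t => t ^ (i + 1 : ℕ)), integral_pow]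
  congr 1
  push_cast
  rw [sub_self, sub_zero, one_pow, zero_pow (by omega), sub_zero]
  ring

lemma expectedOpt_le (n : ℕ) : expectedOpt uniform01 n ≤ ENNReal.ofReal (1 + Real.log n) := by
  calc expectedOpt uniform01 n
      ≤ ∫⁻ x, ∑ i, ENNReal.ofReal (prefixMin x i) ∂costLaw uniform01 n := by
        refine lintegral_mono_ae ?_
        filter_upwards [ae_costLaw_mem_Ioc n] with x hx
        obtain ⟨t, ht, hcost⟩ := exists_covers_totalCost_eq x
        refine (iInf_le _ ⟨t, ht⟩).trans ?_
        rw [hcost, ENNReal.ofReal_sum_of_nonneg fun i _ =>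
          prefixMin_nonneg (fun j => (hx j).1.le) i]
    _ = ∑ i : Fin n, ENNReal.ofReal (1 / ((i : ℝ) + 2)) := by
        rw [lintegral_finsetSum _ fun i _ => (measurable_prefixMin i).ennreal_ofReal]
        exact Finset.sum_congr rfl fun i _ => lintegral_prefixMin i
    _ ≤ ENNReal.ofReal (1 + Real.log n) := by
        rw [← ENNReal.ofReal_sum_of_nonneg fun i _ => by positivity]
        refine ENNReal.ofReal_le_ofReal (le_trans ?_ (harmonic_le_one_add_log n))
        rw [harmonic, Rat.cast_sum, Finset.sum_range]
        refine Finset.sum_le_sum fun i _ => ?_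
        push_cast
        rw [one_div]
        exact inv_anti₀ (by positivity) (by linarith)

/-! ### Passage to the limit -/

/-- The quotient of the bounds for the online and the offline cost tends to `rate a`. -/
lemma tendsto_rate_mul_log_div {a : ℝ} (ha : 2 < a) :
    Tendsto (fun n : ℕ => rate a * Real.log (n / (a * a)) / (1 + Real.log n)) atTop
      (nhds (rate a)) := by
  have hlog : Tendsto (fun n : ℕ => 1 + Real.log n) atTop atTop :=
    tendsto_atTop_add_const_left _ _ (Real.tendsto_log_atTop.comp tendsto_natCast_atTop_atTop)
  have h : Tendsto (fun n : ℕ => rate a - rate a * (1 + Real.log (a * a)) / (1 + Real.log n))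
      atTop (nhds (rate a - 0)) := tendsto_const_nhds.sub (hlog.const_div_atTop _)
  rw [sub_zero] at h
  refine h.congr' ?_
  filter_upwards [hlog.eventually_gt_atTop 0, eventually_gt_atTop 0] with n hn hn0
  have hn0' : (n : ℝ) ≠ 0 := by positivity
  have ha0 : a ≠ 0 := by linarith
  rw [Real.log_div hn0' (mul_ne_zero ha0 ha0)]
  field_simp
  ring

lemma ofReal_rate_le_competitiveRatio {a : ℝ} (ha : 2 < a)
    (A : (n : ℕ) → OnlineAlgorithm.{u} uniform01 n) :
    ENNReal.ofReal (rate a) ≤ competitiveRatio A := by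
  have hlim := (ENNReal.continuous_ofReal.tendsto _).comp (tendsto_rate_mul_log_div ha)
  rw [← hlim.limsup_eq, competitiveRatio]
  refine limsup_le_limsup ?_
  have hlog : Tendsto (fun n : ℕ => 1 + Real.log n) atTop atTop :=
    tendsto_atTop_add_const_left _ _ (Real.tendsto_log_atTop.comp tendsto_natCast_atTop_atTop)
  filter_upwards [hlog.eventually_gt_atTop 0] with n hn
  simp only [Function.comp]
  rw [ENNReal.ofReal_div_of_pos hn]
  refine ENNReal.div_le_div (le_trans (ENNReal.ofReal_le_ofReal ?_)
    ((A n).potential_le_expectedCost ha)) (expectedOpt_le n)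
  have := rate_mul_log_le_potential ha 0 n
  rwa [Nat.cast_zero, zero_add] at this

end Hiring

theorem mainTheorem5
    (A : (n : ℕ) → Hiring.OnlineAlgorithm.{u} Hiring.uniform01 n) :
    2 ≤ Hiring.competitiveRatio A := by
  have h : Tendsto Hiring.rate atTop (nhds (2 * (1 - 0))) :=
    (tendsto_const_nhds.sub (tendsto_id.const_div_atTop 2)).const_mul 2
  have h2 := (ENNReal.continuous_ofReal.tendsto _).comp h
  have e : ENNReal.ofReal (2 * (1 - 0)) = 2 := by norm_num
  rw [e] at h2
  refine le_of_tendsto h2 ?_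
  filter_upwards [eventually_gt_atTop 2] with a ha
  exact Hiring.ofReal_rate_le_competitiveRatio ha A
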